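/- Let $p$ be an odd prime and let $D_{2p}=\langle\tau,\sigma\mid\tau^p=\sigma^2=e,\ \sigma\tau\sigma=\tau^{-1}\rangle$ be the dihedral group of order $2p$. For a group $G$ and a subset $S\subseteq G\setminus\{e\}$, the Cayley digraph $\mathrm{Cay}(G,S)$ has vertex set $G$ and an arc from $g$ to $h$ if and only if $hg^{-1}\in S$; each of its vertices has out-degree $|S|$. Let $\mathcal{M}_k$ denote the number of Cayley digraphs on $D_{2p}$ of out-degree $k$ up to isomorphism of digraphs. Then $$ \mathcal{M}_k=\begin{cases} 1 & \text{if } k=0 \text{ or } k=2p-1,\\[4pt] \dfrac{1}{p}\left[\dbinom{p-1}{k}-\dbinom{2p-1}{k}\right]+\mathcal{M}_k^1 & \text{if } 1\le k\le p-1,\\[10pt] \dfrac{1}{p}\left[\dbinom{p-1}{k-p}-\dbinom{2p-1}{k}\right]+\mathcal{M}_k^1 & \text{if } p\le k\le 2p-2, \end{cases} $$ where $$ \mathcal{M}_k^1=\frac{1}{p-1}\left[\sum_{d\mid\gcd(p-1,k)}\Phi(d)\binom{2(p-1)/d}{k/d}+\sum_{d\mid\gcd(p-1,k-1)}\Phi(d)\binom{2(p-1)/d}{(k-1)/d}\right],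 $$ the sums run over positive divisors $d$, $\gcd(p-1,0)=p-1$, and $\Phi$ is Euler's totient function. -/

import Mathlib

/-- The Cayley digraph `Cay(G, S)`: vertex set `G`, with an arc from `g` to `h` iff
`h * g⁻¹ ∈ S`. -/
def cayleyDigraph {G : Type*} [Group G] (S : Set G) : Digraph G where
  Adj g h := h * g⁻¹ ∈ S

/-- A digraph with vertex set `G` is a Cayley digraph on the group `G` if it is `Cay(G, S)` for
some `S ⊆ G` not containing the identity. -/
def IsCayleyDigraph {G : Type*} [Group G] (Γ : Digraph G) : Prop :=
  ∃ S : Set G, (1 : G) ∉ S ∧ Γ = cayleyDigraph S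

/-- Every vertex of the digraph has exactly `k` out-neighbours. -/
def HasOutDegree {V : Type*} (Γ : Digraph V) (k : ℕ) : Prop :=
  ∀ v : V, {w : V | Γ.Adj v w}.encard = k

/-- Isomorphism of digraphs: a bijection of the vertex sets preserving arcs in both directions. -/
def DigraphIsomorphic {V W : Type*} (Γ : Digraph V) (Δ : Digraph W) : Prop :=
  Nonempty (Γ.Adj ≃r Δ.Adj)

/-- Isomorphism as an equivalence relation on the Cayley digraphs on `G` of out-degree `k`. -/
def cayleyDigraphIsoSetoid (G : Type*) [Group G] (k : ℕ) :
    Setoid {Γ : Digraph G // IsCayleyDigraph Γ ∧ HasOutDegree Γ k} where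
  r Γ Δ := DigraphIsomorphic Γ.1 Δ.1
  iseqv :=
    { refl := fun Γ => ⟨RelIso.refl Γ.1.Adj⟩
      symm := fun h => h.elim fun e => ⟨e.symm⟩
      trans := fun h h' => h.elim fun e => h'.elim fun e' => ⟨e.trans e'⟩ }

/-- The number of Cayley digraphs on `G` of out-degree `k` up to isomorphism. -/
noncomputable def numCayleyDigraphs (G : Type*) [Group G] (k : ℕ) : ℕ :=
  Nat.card (Quotient (cayleyDigraphIsoSetoid G k))

/-- The term `M_k^1` of the counting formula (used for `1 ≤ k`). All the quotients of natural
numbers by `d` that occur in it are exact. -/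
def cayleyTotientTerm (p k : ℕ) : ℚ :=
  1 / ((p : ℚ) - 1) *
    (∑ d ∈ (Nat.gcd (p - 1) k).divisors,
        (Nat.totient d : ℚ) * (Nat.choose (2 * (p - 1) / d) (k / d) : ℚ) +
      ∑ d ∈ (Nat.gcd (p - 1) (k - 1)).divisors,
        (Nat.totient d : ℚ) * (Nat.choose (2 * (p - 1) / d) ((k - 1) / d) : ℚ))

/-! Isomorphic Cayley digraphs on D_{2p} have connection sets related by a group automorphism `r i ↦
r (a * i)`, `sr i ↦ sr (a * i + c)` (the DCI property, `exists_autMapsTo_of_digraphIsomorphic`).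
Right multiplication by `r 1` and its conjugate under an isomorphism are both automorphisms of order
p of the target digraph. For odd p, p^3 does not divide (2p)!, so the Sylow p-subgroups of that
automorphism group are abelian, and after a change of isomorphism the two commute. The isomorphism
is then affine on rotations and on reflections. If its two slopes differ, the connection set
contains all reflections or none, so the slope on rotations serves for both.

The isomorphism classes are therefore the orbits of the affine group of `ZMod p`, of order p(p-1),
on k-subsets of the 2p-1 nonidentity elements, and Burnside's lemma counts them. The invariant
subsets have enumerator (1+X)^(2p-1) for the identity, (1+X)^(p-1) (1+X^p) for each of the p-1
nontrivial translations, and (1+X) (1+X^d)^(2(p-1)/d) for each map whose linear part has order d >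
1. There are φ(d) units of order d; the factor 1+X yields the two totient sums. -/

open Polynomial Finset in
/-- The generating function, by cardinality, of the finite sets invariant under a permutation. -/
noncomputable def invariantEnumerator {α : Type*} [Fintype α] (f : Equiv.Perm α) : ℕ[X] :=
  open scoped Classical in
  ∑ s : Finset α with ∀ x, f x ∈ s ↔ x ∈ s, X ^ #s

/-! ### Enumerating the invariant sets of a permutation. -/

section InvariantEnumerator

open Polynomial Finset

variable {α β : Type*} [Fintype α] [Fintype β]

theorem coeff_invariantEnumerator (f : Equiv.Perm α) (k : ℕ) :
    (invariantEnumerator f).coeff k =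
      Nat.card {s : Finset α // (∀ x, f x ∈ s ↔ x ∈ s) ∧ #s = k} := by
  classical
  rw [invariantEnumerator, finsetSum_coeff]
  simp only [coeff_X_pow]
  rw [Finset.sum_boole, Finset.filter_filter, Nat.card_eq_fintype_card, Fintype.card_subtype]
  simp [eq_comm]

theorem invariantEnumerator_congr (e : α ≃ β) {f : Equiv.Perm α} {g : Equiv.Perm β}
    (h : ∀ x, e (f x) = g (e x)) : invariantEnumerator f = invariantEnumerator g := by
  classical
  refine Finset.sum_bij' (fun s _ => s.map e.toEmbedding) (fun s _ => s.map e.symm.toEmbedding)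
    ?_ ?_ ?_ ?_ ?_
  · intro s hs
    simp only [mem_filter, mem_univ, true_and] at hs ⊢
    intro y
    obtain ⟨x, rfl⟩ := e.surjective y
    rw [← h]
    simpa using hs x
  · intro s hs
    simp only [mem_filter, mem_univ, true_and] at hs ⊢
    intro x
    have := hs (e x)
    rw [← h] at this
    simpa [Finset.mem_map_equiv] using this
  · intro s _; ext x; simp
  · intro s _; ext x; simp
  · intro s _; simp

theorem invariantEnumerator_sumCongr (f : Equiv.Perm α) (g : Equiv.Perm β) :
    invariantEnumerator (Equiv.sumCongr f g) = invariantEnumerator f * invariantEnumerator g := by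
  classical
  rw [invariantEnumerator, invariantEnumerator, invariantEnumerator, Finset.sum_mul_sum,
    ← Finset.sum_product']
  refine Finset.sum_bij' (fun s _ => (s.toLeft, s.toRight)) (fun s _ => s.1.disjSum s.2)
    ?_ ?_ ?_ ?_ ?_
  · intro s hs
    simpa using hs
  · intro s hs
    simpa using hs
  · intro s _; exact toLeft_disjSum_toRight
  · intro s _; simp
  · intro s _
    rw [← pow_add, card_toLeft_add_card_toRight]

/-- All the cycles of `f` have length `d`. -/
theorem invariantEnumerator_of_pow_apply_eq_iff (f : Equiv.Perm α) {d : ℕ}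
    (h : ∀ x n, (f ^ n) x = x ↔ d ∣ n) :
    invariantEnumerator f = (1 + X ^ d) ^ (Fintype.card α / d) := by
  classical
  let st := Equiv.Perm.SameCycle.setoid f
  let π : α → Quotient st := Quotient.mk st
  have hπf (x : α) : π (f x) = π x :=
    Quotient.sound (Equiv.Perm.sameCycle_apply_left.2 (Equiv.Perm.SameCycle.refl f x))
  have hsurj : Function.Surjective π := Quotient.mk_surjective
  have hinv (s : Finset α) (hs : ∀ x, f x ∈ s ↔ x ∈ s) {x y : α} (hxy : π x = π y) :
      x ∈ s ↔ y ∈ s := by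
    obtain ⟨i, -, -, rfl⟩ := Equiv.Perm.SameCycle.exists_pow_eq'' (Quotient.exact hxy)
    clear hxy
    induction i with
    | zero => simp
    | succ i ih => rw [ih, pow_succ', Equiv.Perm.mul_apply, hs]
  have hfib (q : Quotient st) : #{x | π x = q} = d := by
    obtain ⟨x, rfl⟩ := hsurj q
    have hd : 0 < d := by
      rcases Nat.eq_zero_or_pos d with rfl | hd
      -- A permutation of a finite set has finite order, which excludes d = 0.
      · have := (h x (orderOf f)).1 (by rw [pow_orderOf_eq_one]; rfl)
        exact absurd (zero_dvd_iff.1 this) (orderOf_pos f).ne'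
      · exact hd
    have hmod (n : ℕ) : (f ^ n) x = (f ^ (n % d)) x := by
      conv_lhs => rw [← Nat.mod_add_div n d, pow_add, Equiv.Perm.mul_apply,
        (h x (d * (n / d))).2 (dvd_mul_right _ _)]
    rw [← Finset.card_range d]
    symm
    refine Finset.card_bij (fun n _ => (f ^ n) x) ?_ ?_ ?_
    · intro n _
      simp only [mem_filter, mem_univ, true_and]
      induction n with
      | zero => rfl
      | succ n ih => rw [pow_succ', Equiv.Perm.mul_apply, hπf, ih (by simp_all; omega)]
    · intro m hm n hn hmn
      have key (m n : ℕ) (hn : n < d) (hle : m ≤ n) (hmn : (f ^ m) x = (f ^ n) x) : m = n := by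
        obtain ⟨k, rfl⟩ := Nat.exists_eq_add_of_le hle
        rw [pow_add, Equiv.Perm.mul_apply] at hmn
        have := Nat.eq_zero_of_dvd_of_lt ((h x k).1 ((f ^ m).injective hmn).symm) (by omega)
        omega
      simp only [mem_range] at hm hn
      rcases le_total m n with hle | hle
      · exact key m n hn hle hmn
      · exact (key n m hm hle hmn.symm).symm
    · intro y hy
      simp only [mem_filter, mem_univ, true_and] at hy
      obtain ⟨i, -, -, rfl⟩ := Equiv.Perm.SameCycle.exists_pow_eq'' (Quotient.exact hy.symm)
      exact ⟨i % d, mem_range.2 (Nat.mod_lt _ hd), (hmod i).symm⟩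
  have hcard (t : Finset (Quotient st)) : #{x | π x ∈ t} = #t * d := by
    rw [Finset.card_eq_sum_card_fiberwise (f := π) (t := t) (by intro x; simp)]
    rw [← smul_eq_mul, ← Finset.sum_const]
    refine Finset.sum_congr rfl fun q hq => ?_
    rw [← hfib q]
    congr 1
    ext x
    simp only [mem_filter, mem_univ, true_and, and_iff_right_iff_imp]
    rintro rfl
    exact hq
  have htot : (Fintype.card α / d) = #(univ : Finset (Quotient st)) := by
    have h1 := hcard univ
    simp only [mem_univ, filter_true, card_univ] at h1
    rw [h1, card_univ]
    rcases isEmpty_or_nonempty α with hα | ⟨⟨x⟩⟩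
    · have : IsEmpty (Quotient st) := ⟨fun q => hα.elim (hsurj q).choose⟩
      simp
    · apply Nat.mul_div_cancel
      rw [← hfib (π x)]
      exact Finset.card_pos.2 ⟨x, by simp⟩
  -- Expanding the product chooses a set of cycles; its union is the invariant set.
  rw [htot, ← Finset.prod_const, Finset.prod_one_add, invariantEnumerator]
  refine Finset.sum_bij' (fun s _ => s.image π) (fun t _ => ({x | π x ∈ t} : Finset α))
    ?_ ?_ ?_ ?_ ?_
  · intro s _; simp
  · intro t _; simp [hπf]
  · intro s hs
    simp only [mem_filter, mem_univ, true_and] at hs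
    ext x
    simp only [mem_image, mem_filter, mem_univ, true_and]
    exact ⟨fun ⟨y, hy, hyx⟩ => (hinv s hs hyx).1 hy, fun hx => ⟨x, hx, rfl⟩⟩
  · intro t _
    ext q
    obtain ⟨x, rfl⟩ := hsurj q
    simp only [mem_image, mem_filter, mem_univ, true_and]
    exact ⟨fun ⟨y, hy, hyx⟩ => hyx ▸ hy, fun hx => ⟨x, hx, rfl⟩⟩
  · intro s hs
    simp only [mem_filter, mem_univ, true_and] at hs
    rw [Finset.prod_const, ← pow_mul, mul_comm, ← hcard]
    congr 2
    ext x
    simp only [mem_image, mem_filter, mem_univ, true_and]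
    exact ⟨fun hx => ⟨x, hx, rfl⟩, fun ⟨y, hy, hyx⟩ => (hinv s hs hyx).1 hy⟩

theorem invariantEnumerator_refl :
    invariantEnumerator (Equiv.refl α) = (1 + X) ^ Fintype.card α := by
  rw [invariantEnumerator_of_pow_apply_eq_iff (d := 1) (Equiv.refl α), pow_one, Nat.div_one]
  intro x n
  change ((1 : Equiv.Perm α) ^ n) x = x ↔ _
  simp

end InvariantEnumerator

/-! ### The affine group and Burnside's lemma. -/

/-- The affine permutations `x ↦ mul * x + add` of `ZMod p`. -/
@[ext]
structure ZModAffine (p : ℕ) where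
  /-- the linear part -/
  mul : (ZMod p)ˣ
  /-- the translation part -/
  add : ZMod p

namespace ZModAffine

open Polynomial Finset

variable {p : ℕ}

instance : Mul (ZModAffine p) := ⟨fun f g => ⟨f.mul * g.mul, f.mul * g.add + f.add⟩⟩
instance : One (ZModAffine p) := ⟨⟨1, 0⟩⟩
instance : Inv (ZModAffine p) := ⟨fun f => ⟨f.mul⁻¹, -(↑f.mul⁻¹ * f.add)⟩⟩

@[simp] theorem mul_mul' (f g : ZModAffine p) : (f * g).mul = f.mul * g.mul := rfl
@[simp] theorem add_mul' (f g : ZModAffine p) : (f * g).add = f.mul * g.add + f.add := rfl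
@[simp] theorem mul_one' : (1 : ZModAffine p).mul = 1 := rfl
@[simp] theorem add_one' : (1 : ZModAffine p).add = 0 := rfl
@[simp] theorem mul_inv' (f : ZModAffine p) : (f⁻¹).mul = f.mul⁻¹ := rfl
@[simp] theorem add_inv' (f : ZModAffine p) : (f⁻¹).add = -(↑f.mul⁻¹ * f.add) := rfl

instance : Group (ZModAffine p) :=
  Group.ofLeftAxioms
    (fun f g h => by ext <;> simp <;> ring)
    (fun f => by ext <;> simp)
    (fun f => by ext <;> simp)

/-- An affine permutation is a pair consisting of a unit and a translation. -/
def equivProd : ZModAffine p ≃ (ZMod p)ˣ × ZMod p where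
  toFun f := (f.mul, f.add)
  invFun x := ⟨x.1, x.2⟩
  left_inv _ := rfl
  right_inv _ := rfl

instance [NeZero p] : Fintype (ZModAffine p) := Fintype.ofEquiv _ equivProd.symm

theorem card_eq [Fact p.Prime] : Fintype.card (ZModAffine p) = (p - 1) * p := by
  rw [Fintype.card_congr equivProd, Fintype.card_prod, ZMod.card_units, ZMod.card]

/-- The linear part acts on the units, the affine permutation itself on `ZMod p`. -/
instance : MulAction (ZModAffine p) ((ZMod p)ˣ ⊕ ZMod p) where
  smul f := Sum.map (fun u => f.mul * u) (fun x => f.mul * x + f.add)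
  one_smul x := by
    rcases x with u | x
    · exact congrArg Sum.inl (one_mul u)
    · exact congrArg Sum.inr (by simp)
  mul_smul f g x := by
    rcases x with u | x
    · exact congrArg Sum.inl (mul_assoc _ _ _)
    · exact congrArg Sum.inr (by simp; ring)

@[simp] theorem smul_inl (f : ZModAffine p) (u : (ZMod p)ˣ) :
    f • (Sum.inl u : (ZMod p)ˣ ⊕ ZMod p) = Sum.inl (f.mul * u) := rfl

@[simp] theorem smul_inr (f : ZModAffine p) (x : ZMod p) :
    f • (Sum.inr x : (ZMod p)ˣ ⊕ ZMod p) = Sum.inr (f.mul * x + f.add) := rfl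

variable [Fact p.Prime]

/-- The enumerator of the finite subsets of `(ZMod p)ˣ ⊕ ZMod p` fixed by `f`. -/
noncomputable def enumerator (f : ZModAffine p) : ℕ[X] :=
  invariantEnumerator (MulAction.toPerm f : Equiv.Perm ((ZMod p)ˣ ⊕ ZMod p))

theorem invariantEnumerator_mulLeft (a : (ZMod p)ˣ) :
    invariantEnumerator (Equiv.mulLeft a) = (1 + X ^ orderOf a) ^ ((p - 1) / orderOf a) := by
  rw [invariantEnumerator_of_pow_apply_eq_iff _ (d := orderOf a), ZMod.card_units]
  intro x n
  rw [Equiv.pow_mulLeft, Equiv.coe_mulLeft, mul_eq_right, orderOf_dvd_iff_pow_eq_one]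

theorem invariantEnumerator_addRight {b : ZMod p} (hb : b ≠ 0) :
    invariantEnumerator (Equiv.addRight b) = 1 + X ^ p := by
  have hp : 0 < p := (Fact.out : p.Prime).pos
  rw [invariantEnumerator_of_pow_apply_eq_iff _ (d := p), ZMod.card, Nat.div_self hp, pow_one]
  intro x n
  have hpow : (Equiv.addRight b ^ n) x = x + n • b := by
    induction n with
    | zero => simp
    | succ n ih =>
      rw [pow_succ', Equiv.Perm.mul_apply, ih, succ_nsmul, ← add_assoc]
      rfl
  rw [hpow, add_eq_left, nsmul_eq_mul, mul_eq_zero,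
    or_iff_left hb, ZMod.natCast_eq_zero_iff]

theorem enumerator_one : enumerator (1 : ZModAffine p) = (1 + X) ^ (2 * p - 1) := by
  have hp : 0 < p := (Fact.out : p.Prime).pos
  have : (MulAction.toPerm (1 : ZModAffine p) : Equiv.Perm ((ZMod p)ˣ ⊕ ZMod p)) =
      Equiv.refl _ := by ext; simp
  rw [enumerator, this, invariantEnumerator_refl, Fintype.card_sum, ZMod.card_units, ZMod.card]
  congr 1
  omega

theorem enumerator_translation {b : ZMod p} (hb : b ≠ 0) :
    enumerator (⟨1, b⟩ : ZModAffine p) = (1 + X) ^ (p - 1) * (1 + X ^ p) := by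
  have : (MulAction.toPerm (⟨1, b⟩ : ZModAffine p) : Equiv.Perm ((ZMod p)ˣ ⊕ ZMod p)) =
      Equiv.sumCongr (Equiv.refl _) (Equiv.addRight b) := by
    ext x; rcases x with u | x <;> simp
  rw [enumerator, this, invariantEnumerator_sumCongr, invariantEnumerator_refl, ZMod.card_units,
    invariantEnumerator_addRight hb]

/-- A field is the disjoint union of `{c}` and of the translates `c + u` of `c` by the units. -/
noncomputable def unitSumUnitsEquiv (c : ZMod p) : Unit ⊕ (ZMod p)ˣ ≃ ZMod p :=
  Equiv.ofBijective (Sum.elim (fun _ => c) (fun u => c + u)) <| by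
    constructor
    · rintro (x | x) (y | y) h <;> simp_all [Units.ext_iff]
    · intro x
      by_cases hx : x = c
      · exact ⟨Sum.inl (), hx.symm⟩
      · exact ⟨Sum.inr (Units.mk0 (x - c) (sub_ne_zero.2 hx)), by simp⟩

@[simp] theorem unitSumUnitsEquiv_inl (c : ZMod p) (u : Unit) :
    unitSumUnitsEquiv c (Sum.inl u) = c := rfl

@[simp] theorem unitSumUnitsEquiv_inr (c : ZMod p) (u : (ZMod p)ˣ) :
    unitSumUnitsEquiv c (Sum.inr u) = c + u := rfl

/-- The map has the unique fixed point `add / (1 - mul)` on `ZMod p`. Recentred there it becomes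
multiplication by `mul`, whose cycles on the nonzero elements all have length `orderOf f.mul`, as on
the first summand. -/
theorem enumerator_of_mul_ne_one {f : ZModAffine p} (hf : f.mul ≠ 1) :
    enumerator f =
      (1 + X) * (1 + X ^ orderOf f.mul) ^ (2 * (p - 1) / orderOf f.mul) := by
  have hf' : (1 : ZMod p) - f.mul ≠ 0 := by
    rw [sub_ne_zero]; intro h; exact hf (Units.ext h.symm)
  have hdvd : orderOf f.mul ∣ p - 1 := by
    rw [← ZMod.card_units p]; exact orderOf_dvd_card
  have h1 : enumerator f = invariantEnumerator (Equiv.sumCongr (Equiv.mulLeft f.mul)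
      (Equiv.sumCongr (Equiv.refl Unit) (Equiv.mulLeft f.mul))) := by
    symm
    refine invariantEnumerator_congr
      (Equiv.sumCongr (Equiv.refl _) (unitSumUnitsEquiv (f.add / (1 - (f.mul : ZMod p))))) ?_
    rintro (u | (u | u))
    · simp
    · simp
      field_simp
      ring
    · simp
      field_simp
      ring
  rw [h1, invariantEnumerator_sumCongr, invariantEnumerator_sumCongr, invariantEnumerator_refl,
    invariantEnumerator_mulLeft, Nat.mul_div_assoc _ hdvd]
  simp
  ring

theorem sum_orderOf_units {M : Type*} [AddCommMonoid M] (F : ℕ → M) :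
    ∑ a : (ZMod p)ˣ, F (orderOf a) = ∑ d ∈ (p - 1).divisors, d.totient • F d := by
  have hp : p - 1 ≠ 0 := by have := (Fact.out : p.Prime).two_le; omega
  rw [← Finset.sum_fiberwise_of_maps_to (g := fun a : (ZMod p)ˣ => orderOf a)
    (t := (p - 1).divisors)]
  · refine Finset.sum_congr rfl fun d hd => ?_
    rw [Finset.sum_congr rfl (g := fun _ => F d) (by intro a ha; simp_all), Finset.sum_const,
      IsCyclic.card_orderOf_eq_totient]
    rw [ZMod.card_units]
    exact Nat.dvd_of_mem_divisors hd
  · intro a _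
    rw [Nat.mem_divisors, ← ZMod.card_units p]
    exact ⟨orderOf_dvd_card, Fintype.card_ne_zero⟩

/-- The term d = 1 on the right counts the identity's enumerator p times, although it occurs once
among the group elements. The p - 1 surplus copies are added on the left, since `ℕ[X]` has no
subtraction. -/
theorem sum_enumerator :
    ∑ f : ZModAffine p, enumerator f + (p - 1) • (1 + X : ℕ[X]) ^ (2 * p - 1) =
      p • (∑ d ∈ (p - 1).divisors, d.totient • ((1 + X) * (1 + X ^ d) ^ (2 * (p - 1) / d))) +
        (p - 1) • ((1 + X) ^ (p - 1) * (1 + X ^ p)) := by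
  have hp : 2 ≤ p := (Fact.out : p.Prime).two_le
  rw [← sum_orderOf_units (p := p) (fun d => (1 + X : ℕ[X]) * (1 + X ^ d) ^ (2 * (p - 1) / d)),
    ← Equiv.sum_comp equivProd.symm, Fintype.sum_prod_type,
    ← Finset.add_sum_erase _ _ (mem_univ (1 : (ZMod p)ˣ)),
    ← Finset.add_sum_erase _ _ (mem_univ (1 : (ZMod p)ˣ)),
    ← Finset.add_sum_erase _ _ (mem_univ (0 : ZMod p))]
  have h0 : enumerator (equivProd.symm (1, 0) : ZModAffine p) = (1 + X) ^ (2 * p - 1) :=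
    enumerator_one
  have h1 : ∑ b ∈ univ.erase (0 : ZMod p), enumerator (equivProd.symm (1, b) : ZModAffine p) =
      (p - 1) • ((1 + X) ^ (p - 1) * (1 + X ^ p)) := by
    refine (Finset.sum_congr rfl fun b hb =>
      enumerator_translation (Finset.ne_of_mem_erase hb)).trans ?_
    simp [ZMod.card]
  have h2 (a : (ZMod p)ˣ) (ha : a ∈ univ.erase 1) :
      ∑ b : ZMod p, enumerator (equivProd.symm (a, b) : ZModAffine p) =
        p • ((1 + X) * (1 + X ^ orderOf a) ^ (2 * (p - 1) / orderOf a)) := by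
    rw [Finset.sum_congr rfl fun b _ => enumerator_of_mul_ne_one
      (f := equivProd.symm (a, b)) (Finset.ne_of_mem_erase ha)]
    simp [equivProd, ZMod.card]
  have h3 : (1 + X : ℕ[X]) * (1 + X ^ orderOf (1 : (ZMod p)ˣ)) ^
      (2 * (p - 1) / orderOf (1 : (ZMod p)ˣ)) = (1 + X) ^ (2 * p - 1) := by
    rw [orderOf_one, pow_one, Nat.div_one, ← pow_succ']
    congr 1
    omega
  have h4 : p • (1 + X : ℕ[X]) ^ (2 * p - 1) =
      (p - 1) • (1 + X) ^ (2 * p - 1) + (1 + X) ^ (2 * p - 1) := by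
    rw [← succ_nsmul]
    congr 1
    omega
  rw [h0, h1, Finset.sum_congr rfl h2, h3, smul_add, h4, ← Finset.smul_sum]
  abel

open scoped Pointwise in
theorem card_orbits_mul (k : ℕ) :
    Nat.card (MulAction.orbitRel.Quotient (ZModAffine p)
      (Set.powersetCard ((ZMod p)ˣ ⊕ ZMod p) k)) * ((p - 1) * p) =
      (∑ f : ZModAffine p, enumerator f).coeff k := by
  classical
  rw [← card_eq, Nat.card_eq_fintype_card,
    ← MulAction.sum_card_fixedBy_eq_card_orbits_mul_card_group, finsetSum_coeff]
  refine Finset.sum_congr rfl fun f _ => ?_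
  rw [enumerator, coeff_invariantEnumerator, ← Nat.card_eq_fintype_card]
  refine Nat.card_congr
    { toFun := fun s => ⟨s.1.1, fun x => ?_, s.1.2⟩
      invFun := fun s => ⟨⟨s.1, s.2.2⟩, ?_⟩
      left_inv := fun _ => rfl
      right_inv := fun _ => rfl }
  · have h : f • s.1.1 = s.1.1 := congrArg Subtype.val s.2
    conv_lhs => rw [← h]
    exact Finset.smul_mem_smul_finset_iff f
  · refine Subtype.ext ?_
    change f • s.1 = s.1
    ext x
    rw [← Finset.inv_smul_mem_iff, ← s.2.1]
    simp

end ZModAffine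

/-! ### Commuting conjugates of elements of order p. -/

section SylowCommute

/-- The automorphism group of a digraph. -/
def Digraph.autSubgroup {V : Type*} (Γ : Digraph V) : Subgroup (Equiv.Perm V) where
  carrier := {f | ∀ x y, Γ.Adj (f x) (f y) ↔ Γ.Adj x y}
  mul_mem' hf hg x y := (hf _ _).trans (hg x y)
  one_mem' _ _ := Iff.rfl
  inv_mem' {f} hf x y := by
    have h := hf (f⁻¹ x) (f⁻¹ y)
    simpa [iff_comm] using h

theorem IsPGroup.isMulCommutative_of_not_pow_three_dvd {G : Type*} [Group G] [Finite G] {p : ℕ}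
    [Fact p.Prime] (hG : IsPGroup p G) (h : ¬ p ^ 3 ∣ Nat.card G) : IsMulCommutative G := by
  obtain ⟨n, hn⟩ := IsPGroup.iff_card.1 hG
  have hlt : n < 3 := by
    by_contra! hle
    exact h (hn ▸ pow_dvd_pow p hle)
  interval_cases n
  · have : Subsingleton G := (Nat.card_eq_one_iff_unique.1 (by simpa using hn)).1
    exact ⟨⟨fun a b => Subsingleton.elim _ _⟩⟩
  · have := isCyclic_of_prime_card (p := p) (by simpa using hn)
    infer_instance
  · exact IsPGroup.isMulCommutative_of_card_eq_prime_sq hn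

/-- If `p ^ 3` does not divide the order of a group, then any two elements of order `p` commute up
to conjugation. -/
theorem exists_commute_conj_of_not_pow_three_dvd {G : Type*} [Group G] [Finite G] {p : ℕ}
    [Fact p.Prime] (h : ¬ p ^ 3 ∣ Nat.card G) {a b : G} (ha : a ^ p = 1) (hb : b ^ p = 1) :
    ∃ g : G, Commute (g * a * g⁻¹) b := by
  have hz {x : G} (hx : x ^ p = 1) : IsPGroup p (Subgroup.zpowers x) := by
    rintro ⟨y, k, rfl⟩
    refine ⟨1, Subtype.ext ?_⟩
    change (x ^ k) ^ p ^ 1 = 1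
    rw [pow_one, ← zpow_natCast, zpow_comm, zpow_natCast, hx, one_zpow]
  -- Conjugating a Sylow subgroup containing a onto one containing b puts both elements in a single
  -- abelian group.
  obtain ⟨P, hP⟩ := (hz ha).exists_le_sylow
  obtain ⟨Q, hQ⟩ := (hz hb).exists_le_sylow
  obtain ⟨g, hg⟩ := MulAction.exists_smul_eq G P Q
  have hQc : IsMulCommutative Q := Q.isPGroup'.isMulCommutative_of_not_pow_three_dvd
    fun hd => h (hd.trans (Subgroup.card_subgroup_dvd_card _))
  have haQ : g * a * g⁻¹ ∈ Q := by
    rw [← hg]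
    exact Subgroup.smul_mem_pointwise_smul a (MulAut.conj g) P.1 (hP (Subgroup.mem_zpowers a))
  have hbQ : b ∈ Q := hQ (Subgroup.mem_zpowers b)
  exact ⟨g, congrArg Subtype.val (hQc.is_comm.comm (⟨_, haQ⟩ : Q) ⟨_, hbQ⟩)⟩

/-- By Legendre's formula the exponent is ⌊2p/p⌋ = 2, as 2p < p^2. Oddness matters: 8 divides 4!. -/
theorem not_pow_three_dvd_factorial_two_mul {p : ℕ} (hp : p.Prime) (hodd : Odd p) :
    ¬ p ^ 3 ∣ (2 * p).factorial := by
  have h2 : 2 < p := lt_of_le_of_ne hp.two_le (by rintro rfl; exact absurd hodd (by decide))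
  rw [hp.pow_dvd_factorial_iff (b := 2) (Nat.log_lt_of_lt_pow (by omega) (by nlinarith))]
  simp [Nat.mul_div_cancel _ hp.pos]

end SylowCommute

/-! ### The DCI property of the dihedral group. -/

namespace DihedralGroup

open Equiv

variable {p : ℕ}

theorem apply_eq_of_commute_mulRight {h : Perm (DihedralGroup p)}
    (hc : Commute h (Equiv.mulRight (r 1))) (x : DihedralGroup p) [NeZero p] (i : ZMod p) :
    h (x * r i) = h x * r i := by
  have h1 (y : DihedralGroup p) : h (y * r 1) = h y * r 1 := Equiv.congr_fun hc.eq y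
  have h2 (n : ℕ) : h (x * r (n : ZMod p)) = h x * r (n : ZMod p) := by
    induction n with
    | zero => rw [Nat.cast_zero, ← one_def, mul_one, mul_one]
    | succ n ih =>
      rw [Nat.cast_succ, ← r_mul_r, ← mul_assoc, h1, ih, mul_assoc]
  simpa using h2 i.val

/-- A permutation of odd order commuting with the right multiplication by a generating rotation
translates the rotations and translates the reflections. -/
theorem exists_translations_of_commute [NeZero p] {h : Perm (DihedralGroup p)} {n : ℕ}
    (hn : Odd n) (hh : h ^ n = 1) (hc : Commute h (Equiv.mulRight (r 1))) :
    ∃ b c : ZMod p, (∀ i, h (r i) = r (i + b)) ∧ ∀ i, h (sr i) = sr (i + c) := by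
  have hr (i : ZMod p) : h (r i) = h (r 0) * r i := by
    rw [← apply_eq_of_commute_mulRight hc, r_mul_r, zero_add]
  have hs (i : ZMod p) : h (sr i) = h (sr 0) * r i := by
    rw [← apply_eq_of_commute_mulRight hc, sr_mul_r, zero_add]
  obtain ⟨m, rfl⟩ := hn
  -- Where `r 0` and `sr 0` go decides where the two cosets of the rotations go. In every case but
  -- the second, the odd power `h ^ (2 * m + 1)` moves `r 0` or `sr 0` to the other coset,
  -- contradicting `hh`.
  rcases h0 : h (r 0) with b | b <;> rcases h1 : h (sr 0) with c | c <;>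
    simp only [h0, h1, r_mul_r, sr_mul_r] at hr hs
  · have key (n : ℕ) : ∃ d, (h ^ (n + 1)) (sr 0) = r d := by
      induction n with
      | zero => exact ⟨c, by simpa using h1⟩
      | succ n ih =>
        obtain ⟨d, hd⟩ := ih
        exact ⟨b + d, by rw [pow_succ', Perm.mul_apply, hd, hr]⟩
    obtain ⟨d, hd⟩ := key (2 * m)
    simp [hh] at hd
  · exact ⟨b, c, fun i => by rw [hr, add_comm], fun i => by rw [hs, add_comm]⟩
  · have key (n : ℕ) : ∃ d, (h ^ (2 * n + 1)) (r 0) = sr d := by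
      induction n with
      | zero => exact ⟨b, by simpa using h0⟩
      | succ n ih =>
        obtain ⟨d, hd⟩ := ih
        exact ⟨b + (c + d), by
          rw [show 2 * (n + 1) + 1 = (2 * n + 1) + 1 + 1 by ring, pow_succ', Perm.mul_apply,
            pow_succ', Perm.mul_apply, hd, hs, hr]⟩
    obtain ⟨d, hd⟩ := key m
    rw [hh] at hd
    exact nomatch (show r 0 = sr d from hd)
  · have key (n : ℕ) : ∃ d, (h ^ (n + 1)) (r 0) = sr d := by
      induction n with
      | zero => exact ⟨b, by simpa using h0⟩
      | succ n ih =>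
        obtain ⟨d, hd⟩ := ih
        exact ⟨c + d, by rw [pow_succ', Perm.mul_apply, hd, hs]⟩
    obtain ⟨d, hd⟩ := key (2 * m)
    rw [hh] at hd
    exact nomatch (show r 0 = sr d from hd)

/-- The automorphism `r i ↦ r (a * i)`, `sr i ↦ sr (a * i + c)` of the dihedral group maps `S`
onto `T`. -/
def AutMapsTo (a : (ZMod p)ˣ) (c : ZMod p) (S T : Set (DihedralGroup p)) : Prop :=
  (∀ i, r i ∈ S ↔ r ((a : ZMod p) * i) ∈ T) ∧ ∀ i, sr i ∈ S ↔ sr ((a : ZMod p) * i + c) ∈ T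

theorem AutMapsTo.digraphIsomorphic {a : (ZMod p)ˣ} {c : ZMod p} {S T : Set (DihedralGroup p)}
    (h : AutMapsTo a c S T) : DigraphIsomorphic (cayleyDigraph S) (cayleyDigraph T) := by
  refine ⟨⟨⟨fun x => match x with
      | r i => r (a * i)
      | sr i => sr (a * i + c),
    fun x => match x with
      | r i => r (↑a⁻¹ * i)
      | sr i => sr (↑a⁻¹ * (i - c)), ?_, ?_⟩, ?_⟩⟩
  · rintro (i | i) <;> simp
  · rintro (i | i) <;> simp
  · rintro (i | i) (j | j)
    · simp [cayleyDigraph, h.1, mul_add]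
    · simp [cayleyDigraph, h.2]
      ring_nf
    · simp [cayleyDigraph, h.2]
      ring_nf
    · simp [cayleyDigraph, h.1, mul_sub]

variable [Fact p.Prime]

/-- Since F turns right multiplication by `r 1` into h, it is affine on each coset, with slope b on
rotations and c on reflections. It need not be a group automorphism when b ≠ c, but the one with a =
b still carries S to T. -/
theorem exists_autMapsTo_of_translations {S T : Set (DihedralGroup p)}
    (F h : Perm (DihedralGroup p))
    (hF : ∀ x y, (cayleyDigraph T).Adj (F x) (F y) ↔ (cayleyDigraph S).Adj x y)
    (hF1 : F 1 = 1) (hh : h ∈ (cayleyDigraph T).autSubgroup)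
    (hFh : ∀ x, F (x * r 1) = h (F x)) {b c : ZMod p}
    (hr : ∀ i, h (r i) = r (i + b)) (hs : ∀ i, h (sr i) = sr (i + c)) :
    ∃ a c, AutMapsTo a c S T := by
  have hmem (x : DihedralGroup p) : x ∈ S ↔ F x ∈ T := by
    simpa [cayleyDigraph, hF1] using (hF 1 x).symm
  have hFr (i : ZMod p) : F (r i) = r (b * i) := by
    have key (n : ℕ) : F (r (n : ZMod p)) = r (b * (n : ZMod p)) := by
      induction n with
      | zero => simpa using hF1
      | succ n ih =>
        rw [Nat.cast_succ, ← r_mul_r, hFh, ih, hr]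
        congr 1
        ring
    simpa using key i.val
  have hb : b ≠ 0 := by
    rintro rfl
    have : F (r 1) = F (r 0) := by rw [hFr, hFr]; simp
    have h10 := F.injective this
    rw [r.injEq] at h10
    exact one_ne_zero h10
  obtain ⟨m, hm⟩ : ∃ m, F (sr 0) = sr m := by
    rcases h0 : F (sr 0) with j | j
    · have : F (sr 0) = F (r (j / b)) := by rw [h0, hFr, mul_div_cancel₀ _ hb]
      simpa using F.injective this
    · exact ⟨j, rfl⟩
  have hFs (i : ZMod p) : F (sr i) = sr (c * i + m) := by
    have key (n : ℕ) : F (sr (n : ZMod p)) = sr (c * (n : ZMod p) + m) := by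
      induction n with
      | zero => simpa using hm
      | succ n ih =>
        rw [Nat.cast_succ, ← sr_mul_r, hFh, ih, hs]
        congr 1
        ring
    simpa using key i.val
  refine ⟨Units.mk0 b hb, m, fun i => ?_, fun i => ?_⟩
  · rw [hmem, hFr, Units.val_mk0]
  · rw [hmem, hFs, Units.val_mk0]
    by_cases hbc : b = c
    · rw [hbc]
    · have hcb : c - b ≠ 0 := sub_ne_zero.2 (Ne.symm hbc)
      -- Applying h to the pair (`1`, `sr j`) gives (`r b`, `sr (j + c)`), so membership of
      -- reflections in T is invariant under translation by c - b, a generator of `ZMod p`.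
      have hstep (j : ZMod p) : sr (j + (c - b)) ∈ T ↔ sr j ∈ T := by
        have := hh 1 (sr j)
        rw [hs, one_def, hr] at this
        rw [show j + (c - b) = j + c + -b by ring]
        simpa [cayleyDigraph] using this
      have key (j : ZMod p) (n : ℕ) : sr (j + (n : ZMod p) * (c - b)) ∈ T ↔ sr j ∈ T := by
        induction n with
        | zero => simp
        | succ n ih =>
          rw [← ih, ← hstep (j + n * (c - b)), Nat.cast_succ, add_mul, one_mul, add_assoc]
      have := key (b * i + m) i.val
      -- Shifting by i(c - b) turns b i + m into c i + m.
      rw [← this]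
      simp only [ZMod.natCast_val, ZMod.cast_id', id_eq]
      ring_nf

/-- Dihedral groups of order `2 * p` with `p` an odd prime are DCI-groups: two Cayley digraphs are
isomorphic only if an automorphism of the group maps one connection set onto the other. -/
theorem exists_autMapsTo_of_digraphIsomorphic (hodd : Odd p) {S T : Set (DihedralGroup p)}
    (hST : DigraphIsomorphic (cayleyDigraph S) (cayleyDigraph T)) : ∃ a c, AutMapsTo a c S T := by
  obtain ⟨f⟩ := hST
  let ρ : Perm (DihedralGroup p) := Equiv.mulRight (r 1)
  let A := (cayleyDigraph T).autSubgroup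
  have hright (S : Set (DihedralGroup p)) (u x y : DihedralGroup p) :
      (cayleyDigraph S).Adj (x * u) (y * u) ↔ (cayleyDigraph S).Adj x y := by
    simp [cayleyDigraph]
  have hρ : ρ ∈ A := fun x y => hright T _ x y
  have hf : f.toEquiv * ρ * f.toEquiv⁻¹ ∈ A := by
    intro x y
    change (cayleyDigraph T).Adj (f (f.symm x * r 1)) (f (f.symm y * r 1)) ↔ _
    rw [f.map_rel_iff, hright, ← f.map_rel_iff]
    simp
  have hρp : ρ ^ p = 1 := by
    rw [Equiv.pow_mulRight, r_one_pow_n]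
    exact Equiv.mulRight_one
  have hA : ¬ p ^ 3 ∣ Nat.card A := fun hd => by
    refine not_pow_three_dvd_factorial_two_mul Fact.out hodd
      (hd.trans ((Subgroup.card_subgroup_dvd_card A).trans ?_))
    rw [Nat.card_perm, nat_card]
  obtain ⟨g, hg⟩ := exists_commute_conj_of_not_pow_three_dvd hA
    (a := ⟨_, hf⟩) (b := ⟨ρ, hρ⟩)
    (Subtype.ext (by change (f.toEquiv * ρ * f.toEquiv⁻¹) ^ p = 1; simp [conj_pow, hρp]))
    (Subtype.ext hρp)
  let F : Perm (DihedralGroup p) := g.1 * f.toEquiv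
  let h : Perm (DihedralGroup p) := F * ρ * F⁻¹
  have hh : h = g.1 * (f.toEquiv * ρ * f.toEquiv⁻¹) * g.1⁻¹ := by
    simp [h, F, mul_assoc]
  have hhA : h ∈ A := hh ▸ A.mul_mem (A.mul_mem g.2 hf) (A.inv_mem g.2)
  have hhρ : Commute h ρ := hh ▸ congrArg Subtype.val hg
  have hhp : h ^ p = 1 := by simp [h, conj_pow, hρp]
  have hF (x y) : (cayleyDigraph T).Adj (F x) (F y) ↔ (cayleyDigraph S).Adj x y :=
    (g.2 _ _).trans f.map_rel_iff
  have hFh (x) : F (x * r 1) = h (F x) := by simp [h, ρ]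
  obtain ⟨b, c, hr, hs⟩ := exists_translations_of_commute hodd hhp hhρ
  -- Right multiplications are digraph automorphisms; this one makes the isomorphism fix `1`.
  let R : Perm (DihedralGroup p) := Equiv.mulRight (F 1)⁻¹
  have hR : R ∈ A := fun x y => hright T _ x y
  have hconj : ∃ b c : ZMod p, (∀ i, (R * h * R⁻¹) (r i) = r (i + b)) ∧
      ∀ i, (R * h * R⁻¹) (sr i) = sr (i + c) := by
    rcases hF1 : F 1 with t | t
    · refine ⟨b, c, fun i => ?_, fun i => ?_⟩ <;> simp [R, hF1, hr, hs] <;> ring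
    -- Here R multiplies by a reflection, which exchanges the cosets and reverses the direction of
    -- translation.
    · refine ⟨-c, -b, fun i => ?_, fun i => ?_⟩ <;> simp [R, hF1, hr, hs] <;> ring
  obtain ⟨b', c', hr', hs'⟩ := hconj
  exact exists_autMapsTo_of_translations (R * F) (R * h * R⁻¹)
    (fun x y => (hR _ _).trans (hF x y)) (by simp [R]) (A.mul_mem (A.mul_mem hR hhA) (A.inv_mem hR))
    (fun x => by simp [hFh]) hr' hs'

end DihedralGroup

/-! ### Isomorphism classes as orbits of k-subsets. -/

namespace DihedralGroup

open Polynomial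

variable {p : ℕ} [Fact p.Prime]

/-- The enumeration of the nonidentity elements of the dihedral group of order `2 * p`. -/
def nonidentityEmb (p : ℕ) [Fact p.Prime] : (ZMod p)ˣ ⊕ ZMod p ↪ DihedralGroup p where
  toFun := Sum.elim (fun u => r (u : ZMod p)) sr
  inj' := by
    rintro (x | x) (y | y) h <;> simp_all [Units.ext_iff]

@[simp] theorem nonidentityEmb_inl (u : (ZMod p)ˣ) :
    nonidentityEmb p (Sum.inl u) = r (u : ZMod p) := rfl

@[simp] theorem nonidentityEmb_inr (x : ZMod p) : nonidentityEmb p (Sum.inr x) = sr x := rfl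

theorem mem_range_nonidentityEmb {x : DihedralGroup p} :
    x ∈ Set.range (nonidentityEmb p) ↔ x ≠ 1 := by
  constructor
  · rintro ⟨u | y, rfl⟩ h
    · exact u.ne_zero (r.inj h)
    · exact nomatch (show sr y = r 0 from h)
  · intro hx
    rcases x with i | i
    · have hi : i ≠ 0 := by
        rintro rfl
        exact hx rfl
      exact ⟨Sum.inl (Units.mk0 i hi), rfl⟩
    · exact ⟨Sum.inr i, rfl⟩

/-- The connection set given by a finite set of nonidentity elements. -/
def connectionSet (s : Finset ((ZMod p)ˣ ⊕ ZMod p)) : Set (DihedralGroup p) :=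
  nonidentityEmb p '' s

theorem one_notMem_connectionSet (s : Finset ((ZMod p)ˣ ⊕ ZMod p)) :
    (1 : DihedralGroup p) ∉ connectionSet s := fun h =>
  mem_range_nonidentityEmb.1 (Set.image_subset_range _ _ h) rfl

theorem nonidentityEmb_mem_connectionSet {s : Finset ((ZMod p)ˣ ⊕ ZMod p)}
    {y : (ZMod p)ˣ ⊕ ZMod p} : nonidentityEmb p y ∈ connectionSet s ↔ y ∈ s :=
  (nonidentityEmb p).injective.mem_set_image

theorem connectionSet_injective : Function.Injective (connectionSet (p := p)) := fun s t h => by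
  ext y
  rw [← nonidentityEmb_mem_connectionSet, h, nonidentityEmb_mem_connectionSet]

theorem exists_connectionSet_eq {S : Set (DihedralGroup p)} (hS : 1 ∉ S) :
    ∃ s, connectionSet s = S := by
  classical
  refine ⟨Finset.univ.filter fun y => nonidentityEmb p y ∈ S, ?_⟩
  ext x
  by_cases hx : x = 1
  · subst hx
    exact iff_of_false (one_notMem_connectionSet _) hS
  · obtain ⟨y, rfl⟩ := mem_range_nonidentityEmb.2 hx
    rw [nonidentityEmb_mem_connectionSet]
    simp

open scoped Pointwise in
theorem autMapsTo_connectionSet_iff [DecidableEq ((ZMod p)ˣ ⊕ ZMod p)]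
    {f : ZModAffine p} {s t : Finset ((ZMod p)ˣ ⊕ ZMod p)} :
    AutMapsTo f.mul f.add (connectionSet s) (connectionSet t) ↔ f • s = t := by
  have hl (u : (ZMod p)ˣ) : r ((f.mul : ZMod p) * (u : ZMod p)) =
      nonidentityEmb p (f • Sum.inl u) := by
    simp
  have hr (x : ZMod p) : sr ((f.mul : ZMod p) * x + f.add) = nonidentityEmb p (f • Sum.inr x) := by
    simp
  constructor
  · intro h
    ext y
    rw [← Finset.inv_smul_mem_iff]
    obtain ⟨z, rfl⟩ : ∃ z, f • z = y := ⟨f⁻¹ • y, smul_inv_smul f y⟩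
    rw [inv_smul_smul]
    rcases z with u | x
    · have := h.1 u
      rwa [hl, ← nonidentityEmb_inl, nonidentityEmb_mem_connectionSet,
        nonidentityEmb_mem_connectionSet] at this
    · have := h.2 x
      rwa [hr, ← nonidentityEmb_inr, nonidentityEmb_mem_connectionSet,
        nonidentityEmb_mem_connectionSet] at this
  · rintro rfl
    refine ⟨fun i => ?_, fun x => ?_⟩
    · by_cases hi : i = 0
      · subst hi
        rw [mul_zero]
        exact iff_of_false (one_notMem_connectionSet _) (one_notMem_connectionSet _)
      · have := hl (Units.mk0 i hi)
        rw [Units.val_mk0] at this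
        rw [this, nonidentityEmb_mem_connectionSet, Finset.smul_mem_smul_finset_iff,
          ← nonidentityEmb_mem_connectionSet]
        simp
    · rw [hr, nonidentityEmb_mem_connectionSet, Finset.smul_mem_smul_finset_iff,
        ← nonidentityEmb_mem_connectionSet]
      simp

theorem hasOutDegree_cayleyDigraph_iff {G : Type*} [Group G] {S : Set G} {k : ℕ} :
    HasOutDegree (cayleyDigraph S) k ↔ S.encard = k := by
  have h (v : G) : {w : G | (cayleyDigraph S).Adj v w}.encard = S.encard := by
    rw [← (mul_left_injective v).encard_image S]
    congr 1
    ext w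
    simp [cayleyDigraph]
  simp [HasOutDegree, h]

theorem encard_connectionSet (s : Finset ((ZMod p)ˣ ⊕ ZMod p)) :
    (connectionSet s).encard = s.card := by
  rw [connectionSet, (nonidentityEmb p).injective.encard_image, Set.encard_coe_eq_coe_finsetCard]

/-- The Cayley digraphs of out-degree `k` correspond to the sets of `k` nonidentity elements. -/
noncomputable def powersetCardEquivCayleyDigraph (p k : ℕ) [Fact p.Prime] :
    Set.powersetCard ((ZMod p)ˣ ⊕ ZMod p) k ≃
      {Γ : Digraph (DihedralGroup p) // IsCayleyDigraph Γ ∧ HasOutDegree Γ k} :=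
  Equiv.ofBijective
    (fun s => ⟨cayleyDigraph (connectionSet s.1),
      ⟨connectionSet s.1, one_notMem_connectionSet s.1, rfl⟩,
      hasOutDegree_cayleyDigraph_iff.2 (by rw [encard_connectionSet, s.2])⟩) <| by
    constructor
    · intro s t h
      refine Subtype.ext (connectionSet_injective (Set.ext fun x => ?_))
      have := congrFun (congrFun (congrArg Digraph.Adj (congrArg Subtype.val h)) 1) x
      simpa [cayleyDigraph] using this
    · rintro ⟨Γ, ⟨S, hS, rfl⟩, hk⟩
      obtain ⟨s, rfl⟩ := exists_connectionSet_eq hS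
      rw [hasOutDegree_cayleyDigraph_iff, encard_connectionSet, Nat.cast_inj] at hk
      exact ⟨⟨s, hk⟩, rfl⟩

open scoped Classical in
theorem numCayleyDigraphs_eq_card_orbits (hodd : Odd p) (k : ℕ) :
    numCayleyDigraphs (DihedralGroup p) k =
      Nat.card (MulAction.orbitRel.Quotient (ZModAffine p)
        (Set.powersetCard ((ZMod p)ˣ ⊕ ZMod p) k)) := by
  refine (Nat.card_congr (Quotient.congr (powersetCardEquivCayleyDigraph p k) ?_)).symm
  intro s t
  -- The orbit relation of s and t provides f with f • t = s, so the digraph isomorphism is read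
  -- from t to s.
  rw [Setoid.comm']
  constructor
  · rintro ⟨f, hf⟩
    exact (autMapsTo_connectionSet_iff.2 (congrArg Subtype.val hf)).digraphIsomorphic
  · intro h
    obtain ⟨a, c, hac⟩ := exists_autMapsTo_of_digraphIsomorphic hodd h
    exact ⟨⟨a, c⟩, Subtype.ext ((autMapsTo_connectionSet_iff (f := ⟨a, c⟩)).1 hac)⟩

theorem numCayleyDigraphs_mul_add (hodd : Odd p) (k : ℕ) :
    numCayleyDigraphs (DihedralGroup p) k * ((p - 1) * p) +
        (p - 1) * ((1 + X : ℕ[X]) ^ (2 * p - 1)).coeff k =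
      p * (∑ d ∈ (p - 1).divisors,
          d.totient * ((1 + X : ℕ[X]) * (1 + X ^ d) ^ (2 * (p - 1) / d)).coeff k) +
        (p - 1) * ((1 + X : ℕ[X]) ^ (p - 1) * (1 + X ^ p)).coeff k := by
  have h := congrArg (fun P => coeff P k) (ZModAffine.sum_enumerator (p := p))
  simp only [coeff_add, coeff_smul, finsetSum_coeff, smul_eq_mul] at h
  rw [← h, numCayleyDigraphs_eq_card_orbits hodd]
  classical
  convert congrArg (· + (p - 1) * ((1 + X : ℕ[X]) ^ (2 * p - 1)).coeff k)
    (ZModAffine.card_orbits_mul (p := p) k) using 2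
  rw [finsetSum_coeff]

theorem numCayleyDigraphs_eq_one {k : ℕ} (hk : k = 0 ∨ k = 2 * p - 1) (hodd : Odd p) :
    numCayleyDigraphs (DihedralGroup p) k = 1 := by
  classical
  rw [numCayleyDigraphs_eq_card_orbits hodd, Nat.card_eq_one_iff_unique]
  have hp : 2 ≤ p := (Fact.out : p.Prime).two_le
  have hcard : Fintype.card ((ZMod p)ˣ ⊕ ZMod p) = 2 * p - 1 := by
    rw [Fintype.card_sum, ZMod.card_units, ZMod.card]
    omega
  have hsub : Nonempty (Unique (Set.powersetCard ((ZMod p)ˣ ⊕ ZMod p) k)) := by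
    rcases hk with rfl | rfl
    · exact ⟨⟨⟨⟨∅, rfl⟩⟩, fun s => Subtype.ext (Finset.card_eq_zero.1 s.2)⟩⟩
    · exact ⟨⟨⟨⟨Finset.univ, hcard⟩⟩, fun s =>
        Subtype.ext (Finset.card_eq_iff_eq_univ _ |>.1 (s.2.trans hcard.symm))⟩⟩
  obtain ⟨h⟩ := hsub
  exact ⟨Quot.Subsingleton, ⟨Quotient.mk _ default⟩⟩

end DihedralGroup

/-! ### Coefficient extraction and the final formula. -/

section Coefficients

open Polynomial Finset

theorem coeff_one_add_X_pow_pow {d : ℕ} (hd : 0 < d) (m k : ℕ) :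
    ((1 + X ^ d : ℕ[X]) ^ m).coeff k = if d ∣ k then m.choose (k / d) else 0 := by
  have : (1 + X ^ d : ℕ[X]) ^ m = expand ℕ d ((1 + X) ^ m) := by simp
  rw [this, coeff_expand hd, coeff_one_add_X_pow]
  simp

theorem coeff_one_add_X_mul {R : Type*} [Semiring R] (P : R[X]) {k : ℕ} (hk : 1 ≤ k) :
    ((1 + X) * P).coeff k = P.coeff k + P.coeff (k - 1) := by
  obtain ⟨k, rfl⟩ := Nat.exists_eq_add_of_le' hk
  simp [add_mul, coeff_X_mul]

theorem coeff_one_add_X_pow_mul (n m k : ℕ) :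
    ((1 + X : ℕ[X]) ^ n * (1 + X ^ m)).coeff k =
      n.choose k + if m ≤ k then n.choose (k - m) else 0 := by
  rw [mul_add, mul_one, coeff_add, coeff_mul_X_pow', coeff_one_add_X_pow, coeff_one_add_X_pow]
  simp

theorem sum_divisors_ite_dvd {M : Type*} [AddCommMonoid M] {n : ℕ} (hn : n ≠ 0) (k : ℕ)
    (F : ℕ → M) :
    ∑ d ∈ n.divisors, (if d ∣ k then F d else 0) = ∑ d ∈ (Nat.gcd n k).divisors, F d := by
  rw [← Finset.sum_filter]
  refine Finset.sum_congr ?_ fun _ _ => rfl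
  ext d
  simp [Nat.dvd_gcd_iff, hn]

theorem sum_totient_mul_coeff {n k : ℕ} (hn : n ≠ 0) (hk : 1 ≤ k) :
    ∑ d ∈ n.divisors, d.totient * ((1 + X : ℕ[X]) * (1 + X ^ d) ^ (2 * n / d)).coeff k =
      ∑ d ∈ (Nat.gcd n k).divisors, d.totient * (2 * n / d).choose (k / d) +
        ∑ d ∈ (Nat.gcd n (k - 1)).divisors, d.totient * (2 * n / d).choose ((k - 1) / d) := by
  rw [← sum_divisors_ite_dvd hn, ← sum_divisors_ite_dvd hn, ← Finset.sum_add_distrib]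
  refine Finset.sum_congr rfl fun d hd => ?_
  have hd0 : 0 < d := Nat.pos_of_mem_divisors hd
  rw [coeff_one_add_X_mul _ hk, coeff_one_add_X_pow_pow hd0, coeff_one_add_X_pow_pow hd0, mul_add,
    mul_ite, mul_ite, mul_zero]

end Coefficients

/-- Both ranges of k are covered at once: the second binomial is absent for k < p, and the first
vanishes for k ≥ p. -/
theorem numCayleyDigraphs_dihedralGroup_eq {p : ℕ} [Fact p.Prime] (hodd : Odd p) {k : ℕ}
    (hk : 1 ≤ k) :
    (numCayleyDigraphs (DihedralGroup p) k : ℚ) =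
      1 / (p : ℚ) * (((p - 1).choose k + if p ≤ k then (p - 1).choose (k - p) else 0 : ℕ) -
        ((2 * p - 1).choose k : ℚ)) + cayleyTotientTerm p k := by
  have hp : 2 ≤ p := (Fact.out : p.Prime).two_le
  have h := DihedralGroup.numCayleyDigraphs_mul_add hodd k
  rw [sum_totient_mul_coeff (by omega) hk, coeff_one_add_X_pow_mul,
    Polynomial.coeff_one_add_X_pow] at h
  have hq := congrArg (Nat.cast : ℕ → ℚ) h
  have hp0 : (p : ℚ) ≠ 0 := by positivity
  have hp1 : (p : ℚ) - 1 ≠ 0 := by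
    have : (2 : ℚ) ≤ p := by exact_mod_cast hp
    linarith
  rw [cayleyTotientTerm]
  generalize ((p - 1).choose k + if p ≤ k then (p - 1).choose (k - p) else 0 : ℕ) = B at hq ⊢
  simp only [Nat.cast_add, Nat.cast_mul, Nat.cast_sub (show 1 ≤ p by omega), Nat.cast_one,
    Nat.cast_sum, Nat.cast_id] at hq
  field_simp
  linear_combination hq

theorem mainTheorem3 (p : ℕ) (hp : p.Prime) (hodd : Odd p) (k : ℕ) :
    ((k = 0 ∨ k = 2 * p - 1) → numCayleyDigraphs (DihedralGroup p) k = 1) ∧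
    ((1 ≤ k ∧ k ≤ p - 1) →
      (numCayleyDigraphs (DihedralGroup p) k : ℚ) =
        1 / (p : ℚ) * ((Nat.choose (p - 1) k : ℚ) - (Nat.choose (2 * p - 1) k : ℚ)) +
          cayleyTotientTerm p k) ∧
    ((p ≤ k ∧ k ≤ 2 * p - 2) →
      (numCayleyDigraphs (DihedralGroup p) k : ℚ) =
        1 / (p : ℚ) * ((Nat.choose (p - 1) (k - p) : ℚ) - (Nat.choose (2 * p - 1) k : ℚ)) +
          cayleyTotientTerm p k) := by
  have : Fact p.Prime := ⟨hp⟩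
  have h2 : 2 ≤ p := hp.two_le
  refine ⟨fun hk => DihedralGroup.numCayleyDigraphs_eq_one hk hodd, fun hk => ?_, fun hk => ?_⟩
  · rw [numCayleyDigraphs_dihedralGroup_eq hodd hk.1, if_neg (by omega), add_zero]
  · rw [numCayleyDigraphs_dihedralGroup_eq hodd (by omega), if_pos hk.1,
      Nat.choose_eq_zero_of_lt (show p - 1 < k by omega), zero_add]
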